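/- For a family $\mathcal I$ of subsets of $\omega=\{0,1,2,\dots\}$ that is an ideal (closed under subsets and finite unions, containing all finite sets, not containing $\omega$), say that a topological space $X$ has the property $\mathrm{BW}(\mathcal I)$ if for every sequence $(x_n)_{n\in\omega}$ in $X$ there are $A\subseteq\omega$ with $A\notin\mathcal I$ and a point $x\in X$ such that $\{n\in A: x_n\notin U\}\in\mathcal I$ for every open neighborhood $U$ of $x$. Let $$\mathcal W=\{A\subseteq\omega:\ \text{for some } n\in\omega,\ A \text{ contains no arithmetic progression of length } n\}$$ be the van der Waerden ideal (progressions have positive difference) and let $$\mathcal I_{1/n}=\Big\{A\subseteq\omega:\ \sum_{n\in A}\frac1{n+1}<\infty\Big\}$$ be the summable ideal. Assume the continuum hypothesis, $2^{\aleph_0}=\aleph_1$. Then there exist: (a) a Hausdorff, sequentially compact, non-compact space without the property $\mathrm{BW}(\mathcal W)$; (b) a Hausdorff, sequentially compact, non-compact space without the property $\mathrm{BW}(\mathcal I_{1/n})$; (c) a Hausdorff space with the property $\mathrm{BW}(\mathcal I_{1/n})$ that is neither compact nor sequentially compact; (d) a Hausdorff non-compact space with the property $\mathrm{BW}(\mathcal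 W)$ but without the property $\mathrm{BW}(\mathcal I_{1/n})$; (e) a Hausdorff non-compact space with the property $\mathrm{BW}(\mathcal I_{1/n})$ but without the property $\mathrm{BW}(\mathcal W)$. -/

import Mathlib

/-- `I⁺`: the subsets of `ω` that are positive with respect to the family `I`. -/
def IdealPositive (I : Set (Set ℕ)) : Set (Set ℕ) := {A | A ∉ I}

/-- The sequence `(x n)` restricted to the indices `n ∈ A` is `I`-convergent to the point `p`. -/
def IdealConvergesTo {X : Type*} [TopologicalSpace X] (I : Set (Set ℕ)) (A : Set ℕ)
    (x : ℕ → X) (p : X) : Prop :=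
  ∀ U : Set X, IsOpen U → p ∈ U → {n | n ∈ A ∧ x n ∉ U} ∈ I

/-- `X` has the property `BW(I)`: every sequence in `X` is `I`-convergent (to some point of `X`)
along some `I`-positive set of indices. -/
def HasBW (I : Set (Set ℕ)) (X : Type*) [TopologicalSpace X] : Prop :=
  ∀ x : ℕ → X, ∃ A ∈ IdealPositive I, ∃ p : X, IdealConvergesTo I A x p

/-- `A` contains an arithmetic progression (with positive difference) of length `n`. -/
def ContainsAP (A : Set ℕ) (n : ℕ) : Prop :=
  ∃ a d : ℕ, 0 < d ∧ ∀ i < n, a + i * d ∈ A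

/-- The van der Waerden ideal `𝒲`: the sets that, for some `n`, contain no arithmetic
progression of length `n`. -/
def vanDerWaerdenIdeal : Set (Set ℕ) := {A | ∃ n : ℕ, ¬ ContainsAP A n}

/-- The summable ideal `I_{1/n}`: the sets `A` for which `∑_{n ∈ A} 1 / (n + 1)` converges. -/
def summableIdeal : Set (Set ℕ) := {A | Summable fun n : A => 1 / ((n : ℕ) + 1 : ℝ)}

/-! Each space is a subspace of a Cantor cube 2^T: the points of countable support together with the
points e_n = (t ↦ [n ∈ S_t]), for a suitable family (S_t). If every J-positive set is split by some
S_t into two J-positive pieces, no restriction of (e_n) to a J-positive set J-converges, so BW(J)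
fails. BW(I) holds if, for every f with fibres in I on an I-positive B, some I-positive C ⊆ B has C
∩ f⁻¹(S_t) ∈ I for all but countably many t, and for the others C ∩ f⁻¹(S_t) or C \ f⁻¹(S_t) in I;
the limit then has countable support.

Under CH such a family arises by recursion of length ω₁ (`exists_space_hasBW_not_hasBW`). Stage t
splits one set by S_t, chosen so that C_s ∩ f_s⁻¹(S_t) ∈ I for the countably many earlier s, and
then picks C_t deciding S_t and all earlier S_s, which needs pseudo-intersections (`IsPPlus`).

It remains to choose S against countably many pairs (f_k, C_k). It is a union of finite blocks
witnessing J-positivity. For (a), (b), (d) each f_k[C_k] lies in J and block j avoids the first j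
images (`exists_space_of_image_mem`). For (c), (e) the fibres of f_k on C_k have mass tending to 0,
and block j has at most j + 1 points, whose fibres under the first j maps have mass at most 2⁻ʲ
(`exists_space_hasBW_summableIdeal`). Sequential compactness enters as BW for the finite ideal. -/

open Set Filter Topology

/-! ### Ideals, pseudo-intersections and recursion along a well-order -/

/-- An ideal of subsets of `ℕ`: proper, closed under subsets and unions, containing the finite
sets. -/
structure IsSetIdeal (I : Set (Set ℕ)) : Prop where
  mono : ∀ {A B : Set ℕ}, A ⊆ B → B ∈ I → A ∈ I
  union : ∀ {A B : Set ℕ}, A ∈ I → B ∈ I → A ∪ B ∈ I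
  finite : ∀ {A : Set ℕ}, A.Finite → A ∈ I
  univ : Set.univ ∉ I

namespace IsSetIdeal

variable {I : Set (Set ℕ)}

theorem empty (hI : IsSetIdeal I) : (∅ : Set ℕ) ∈ I := hI.finite finite_empty

theorem biUnion (hI : IsSetIdeal I) {ι : Type*} {s : Set ι} (hs : s.Finite) {A : ι → Set ℕ}
    (h : ∀ i ∈ s, A i ∈ I) : (⋃ i ∈ s, A i) ∈ I := by
  induction s, hs using Set.Finite.induction_on with
  | empty => simpa using hI.empty
  | insert _ _ ih =>
    rw [biUnion_insert]
    exact hI.union (h _ (mem_insert _ _)) (ih fun i hi => h i (mem_insert_of_mem _ hi))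

theorem diff_not_mem (hI : IsSetIdeal I) {A B : Set ℕ} (hA : A ∉ I) (hB : B ∈ I) :
    A \ B ∉ I := fun h =>
  hA (hI.mono (by intro x hx; by_cases hxB : x ∈ B <;> simp [hx, hxB]) (hI.union h hB))

theorem inter_or_diff (hI : IsSetIdeal I) {A : Set ℕ} (hA : A ∉ I) (E : Set ℕ) :
    A ∩ E ∉ I ∨ A \ E ∉ I := by
  by_contra! h
  exact hA (inter_union_sdiff A E ▸ hI.union h.1 h.2)

end IsSetIdeal

/-- The ideal of finite sets. -/
def finiteIdeal : Set (Set ℕ) := {A | A.Finite}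

theorem isSetIdeal_finiteIdeal : IsSetIdeal finiteIdeal where
  mono h hB := Set.Finite.subset hB h
  union := Set.Finite.union
  finite h := h
  univ := Set.infinite_univ

/-- Every decreasing sequence of positive sets has a positive pseudo-intersection. -/
def IsPPlus (I : Set (Set ℕ)) : Prop :=
  ∀ B : ℕ → Set ℕ, Antitone B → (∀ j, B j ∉ I) →
    ∃ C, C ⊆ B 0 ∧ C ∉ I ∧ ∀ j, (C \ B j).Finite

/-- Below every positive set there is a positive set which is almost contained in, or almost
disjoint from, each member of a given countable family. -/
theorem IsPPlus.exists_decided {I : Set (Set ℕ)} (hP : IsPPlus I) (hI : IsSetIdeal I)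
    {B : Set ℕ} (hB : B ∉ I) {ι : Type*} [Countable ι] (E : ι → Set ℕ) :
    ∃ C ⊆ B, C ∉ I ∧ ∀ i, (C ∩ E i).Finite ∨ (C \ E i).Finite := by
  rcases isEmpty_or_nonempty ι with _ | _
  · exact ⟨B, Subset.rfl, hB, isEmptyElim⟩
  obtain ⟨e, he⟩ := exists_surjective_nat ι
  -- One half of a positive set is positive, so the sets E i are decided one at a time along a
  -- decreasing sequence.
  have step : ∀ (n : ℕ) (D : {D : Set ℕ // D ∉ I}), ∃ D' : {D : Set ℕ // D ∉ I},
      D'.1 = D.1 ∩ E (e n) ∨ D'.1 = D.1 \ E (e n) := fun n D => by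
    rcases hI.inter_or_diff D.2 (E (e n)) with h | h
    exacts [⟨⟨_, h⟩, Or.inl rfl⟩, ⟨⟨_, h⟩, Or.inr rfl⟩]
  choose F hF using step
  let D : ℕ → {D : Set ℕ // D ∉ I} := fun n => Nat.rec ⟨B, hB⟩ F n
  have hD : ∀ n, (D (n + 1)).1 = (D n).1 ∩ E (e n) ∨ (D (n + 1)).1 = (D n).1 \ E (e n) :=
    fun n => hF n (D n)
  have hanti : Antitone fun n => (D n).1 := antitone_nat_of_succ_le fun n => by
    rcases hD n with h | h <;> simp only [h]
    exacts [inter_subset_left, sdiff_subset]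
  obtain ⟨C, hC0, hC, hfin⟩ := hP _ hanti fun n => (D n).2
  refine ⟨C, hC0, hC, fun i => ?_⟩
  obtain ⟨n, rfl⟩ := he i
  rcases hD n with h | h
  · refine Or.inr ((hfin (n + 1)).subset fun x hx => ⟨hx.1, fun h' => hx.2 ?_⟩)
    rw [h] at h'
    exact h'.2
  · refine Or.inl ((hfin (n + 1)).subset fun x hx => ⟨hx.1, fun h' => ?_⟩)
    rw [h] at h'
    exact h'.2 hx.2

/-- Choice along a well-founded relation. -/
theorem WellFounded.exists_forall_rel {T α : Type*} [Nonempty α] {r : T → T → Prop}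
    (hr : WellFounded r) (P : T → α → Prop) (R : T → α → T → α → Prop)
    (h : ∀ (t : T) (g : T → α), (∀ s, r s t → P s (g s)) →
      ∃ a, P t a ∧ ∀ s, r s t → R s (g s) t a) :
    ∃ g : T → α, ∀ t, P t (g t) ∧ ∀ s, r s t → R s (g s) t (g t) := by
  classical
  let g : T → α := hr.fix fun t prev =>
    Classical.epsilon fun a => P t a ∧ ∀ (s : T) (hs : r s t), R s (prev s hs) t a
  have hg : ∀ t, g t = Classical.epsilon fun a => P t a ∧ ∀ s, r s t → R s (g s) t a :=
    fun t => hr.fix_eq _ t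
  refine ⟨g, fun t => ?_⟩
  induction t using hr.induction with
  | _ t ih =>
    have := Classical.epsilon_spec (h t g fun s hs => (ih s hs).1)
    rw [← hg t] at this
    exact this

/-- In a well-order of minimal type ω₁, proper initial segments have cardinality below ℵ₁. -/
theorem exists_wellOrder_countable_initial {T : Type}
    (hT : Cardinal.mk T = Cardinal.aleph.{0} 1) :
    ∃ r : T → T → Prop, IsWellOrder T r ∧ ∀ t, {s | r s t}.Countable := by
  obtain ⟨r, wo, hr⟩ := Cardinal.exists_ord_eq T
  refine ⟨r, wo, fun t => ?_⟩
  have h1 := Ordinal.typein_lt_type r t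
  rw [← hr, hT, Cardinal.lt_ord] at h1
  rw [← Cardinal.le_aleph0_iff_set_countable, ← Order.lt_succ_iff, Cardinal.succ_aleph0]
  exact h1

/-! ### The space attached to a family of sets -/

section Space

variable {T : Type} {S : T → Set ℕ} {I J : Set (Set ℕ)}

/-- The points of the Cantor cube `2 ^ T` with countable support together with the functions
`t ↦ [n ∈ S t]`, for `n : ℕ`. -/
abbrev SplitSpace (S : T → Set ℕ) : Type :=
  {z : T → Bool // {t | z t = true}.Countable ∨ ∃ n, ∀ t, z t = true ↔ n ∈ S t}

namespace SplitSpace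

open Classical in
/-- The point `t ↦ [n ∈ S t]`. -/
noncomputable def point (S : T → Set ℕ) (n : ℕ) : SplitSpace S :=
  ⟨fun t => decide (n ∈ S t), Or.inr ⟨n, fun _ => by simp⟩⟩

/-- The characteristic function of a countable set. -/
noncomputable def ofCountable (S : T → Set ℕ) (D : Set T) (hD : D.Countable) : SplitSpace S :=
  ⟨fun t => open Classical in decide (t ∈ D), Or.inl (by simpa using hD)⟩

@[simp] theorem point_apply {n : ℕ} {t : T} : (point S n).1 t = true ↔ n ∈ S t := by
  simp [point]

@[simp] theorem ofCountable_apply {D : Set T} {hD : D.Countable} {t : T} :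
    (ofCountable S D hD).1 t = true ↔ t ∈ D := by
  simp [ofCountable]

theorem isOpen_coord (t : T) (b : Bool) : IsOpen {z : SplitSpace S | z.1 t = b} :=
  have h : Continuous fun z : SplitSpace S => z.1 t :=
    (continuous_apply t).comp continuous_subtype_val
  (isOpen_discrete {b}).preimage h

theorem idealConvergesTo (hI : IsSetIdeal I) {A : Set ℕ} {x : ℕ → SplitSpace S}
    {p : SplitSpace S} (h : ∀ t, {n | n ∈ A ∧ (x n).1 t ≠ p.1 t} ∈ I) :
    IdealConvergesTo I A x p := by
  intro U hU hp
  obtain ⟨V, hV, rfl⟩ := isOpen_induced_iff.1 hU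
  obtain ⟨F, u, hu, hsub⟩ := isOpen_pi_iff.1 hV p.1 hp
  refine hI.mono ?_ (hI.biUnion F.finite_toSet fun t _ => h t)
  rintro n ⟨hn, hnU⟩
  by_contra hcon
  simp only [mem_iUnion, mem_ofPred_eq, not_exists, not_and, not_not] at hcon
  exact hnU (hsub fun t ht => by rw [hcon t ht hn]; exact (hu t ht).2)

theorem not_hasBW (h : ∀ B ∉ J, ∃ t, S t ⊆ B ∧ S t ∉ J ∧ B \ S t ∉ J) :
    ¬ HasBW J (SplitSpace S) := by
  intro hBW
  obtain ⟨B, hB, p, hp⟩ := hBW (point S)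
  obtain ⟨t, hsub, h1, h2⟩ := h B hB
  have := hp _ (isOpen_coord t (p.1 t)) rfl
  cases hpt : p.1 t
  · refine h1 ?_
    convert this using 1
    ext n
    simp only [mem_ofPred_eq, hpt, Bool.not_eq_false, point_apply]
    exact ⟨fun h => ⟨hsub h, h⟩, fun h => h.2⟩
  · refine h2 ?_
    convert this using 1
    ext n
    simp [hpt]

/-- The open sets {z | z t = false} cover the space, but the characteristic function of a finite F ⊆
T escapes those with t ∈ F. -/
theorem not_compactSpace [Uncountable T] (h : ∀ n, ∃ t, n ∉ S t) :
    ¬ CompactSpace (SplitSpace S) := by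
  intro hc
  obtain ⟨F, hF⟩ := isCompact_univ.elim_finite_subcover
    (fun t => {z : SplitSpace S | z.1 t = false}) (fun t => isOpen_coord t false) (by
      rintro ⟨z, hz⟩ -
      rw [mem_iUnion]
      rcases hz with hz | ⟨n, hn⟩
      · by_contra! hcon
        refine not_countable_univ (α := T) (hz.mono fun t _ => ?_)
        simpa using hcon t
      · obtain ⟨t, ht⟩ := h n
        refine ⟨t, ?_⟩
        have := (hn t).not.2 ht
        simpa using this)
  have := hF (mem_univ (ofCountable S (F : Set T) F.countable_toSet))
  simp only [mem_iUnion, mem_ofPred_eq, ← Bool.not_eq_true, ofCountable_apply] at this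
  obtain ⟨t, ht, ht'⟩ := this
  exact ht' ht

theorem hasBW (hI : IsSetIdeal I) (hP : IsPPlus I)
    (h : ∀ (f : ℕ → ℕ) (B : Set ℕ), B ∉ I → (∀ n, B ∩ f ⁻¹' {n} ∈ I) →
      ∃ C ⊆ B, C ∉ I ∧ ∃ D : Set T, D.Countable ∧
        (∀ t ∈ D, C ∩ f ⁻¹' S t ∈ I ∨ C \ f ⁻¹' S t ∈ I) ∧ ∀ t ∉ D, C ∩ f ⁻¹' S t ∈ I) :
    HasBW I (SplitSpace S) := by
  intro x
  -- a positive set of indices on which every coordinate is decided gives a limit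
  have key : ∀ C ∉ I, ∀ D : Set T, D.Countable →
      (∀ t ∈ D, C ∩ {n | (x n).1 t = true} ∈ I ∨ C \ {n | (x n).1 t = true} ∈ I) →
      (∀ t ∉ D, C ∩ {n | (x n).1 t = true} ∈ I) →
      ∃ A ∈ IdealPositive I, ∃ p : SplitSpace S, IdealConvergesTo I A x p := by
    intro C hC D hD h1 h2
    refine ⟨C, hC, ofCountable S {t | C ∩ {n | (x n).1 t = true} ∉ I}
      (hD.mono fun t ht => by_contra fun htD => ht (h2 t htD)), idealConvergesTo hI fun t => ?_⟩
    by_cases ht : C ∩ {n | (x n).1 t = true} ∈ I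
    · have hp : (ofCountable S {t | C ∩ {n | (x n).1 t = true} ∉ I}
          (hD.mono fun t ht => by_contra fun htD => ht (h2 t htD))).1 t = false := by
        rw [← Bool.not_eq_true, ofCountable_apply]
        exact not_not.2 ht
      convert ht using 1
      ext n
      simp [hp]
    · have hp : (ofCountable S {t | C ∩ {n | (x n).1 t = true} ∉ I}
          (hD.mono fun t ht => by_contra fun htD => ht (h2 t htD))).1 t = true :=
        ofCountable_apply.2 ht
      have htD : t ∈ D := by_contra fun htD => ht (h2 t htD)
      convert (h1 t htD).resolve_left ht using 1
      ext n
      simp [hp]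
  -- Either countably supported terms occur on a positive set, and only countably many coordinates
  -- matter, or the terms of the form e_n do.
  rcases hI.inter_or_diff hI.univ {i | {t | (x i).1 t = true}.Countable} with hB | hB
  · rw [univ_inter] at hB
    set B := {i | {t | (x i).1 t = true}.Countable}
    have hD : (⋃ i ∈ B, {t | (x i).1 t = true}).Countable :=
      (to_countable B).biUnion fun i hi => hi
    set D := ⋃ i ∈ B, {t | (x i).1 t = true} with hDdef
    have := hD.to_subtype
    obtain ⟨C, hCB, hC, hdec⟩ := hP.exists_decided hI hB fun t : D => {n | (x n).1 t = true}
    refine key C hC D hD (fun t ht => (hdec ⟨t, ht⟩).imp hI.finite hI.finite) fun t ht => ?_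
    convert hI.empty
    refine eq_empty_of_forall_notMem fun n hn => ht ?_
    exact mem_biUnion (hCB hn.1) hn.2
  · have hx : ∀ i, ∃ n, i ∈ univ \ {i | {t | (x i).1 t = true}.Countable} →
        ∀ t, (x i).1 t = true ↔ n ∈ S t := fun i => by
      rcases (x i).2 with h | ⟨n, hn⟩
      exacts [⟨0, fun h' => (h'.2 h).elim⟩, ⟨n, fun _ => hn⟩]
    choose f hf using hx
    set B := univ \ {i | {t | (x i).1 t = true}.Countable}
    by_cases hfib : ∀ n, B ∩ f ⁻¹' {n} ∈ I
    · obtain ⟨C, hCB, hC, D, hD, h1, h2⟩ := h f B hB hfib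
      have hset : ∀ t, C ∩ {n | (x n).1 t = true} = C ∩ f ⁻¹' S t ∧
          C \ {n | (x n).1 t = true} = C \ f ⁻¹' S t := fun t => by
        constructor <;> ext i <;>
        · simp only [mem_inter_iff, Set.mem_sdiff, mem_ofPred_eq, mem_preimage]
          refine and_congr_right fun hi => ?_
          rw [hf i (hCB hi) t]
      exact key C hC D hD (fun t ht => by rw [(hset t).1, (hset t).2]; exact h1 t ht)
        fun t ht => by rw [(hset t).1]; exact h2 t ht
    -- On a positive fibre of f the sequence is constant.
    · push Not at hfib
      obtain ⟨n, hn⟩ := hfib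
      refine ⟨_, hn, point S n, idealConvergesTo hI fun t => ?_⟩
      convert hI.empty
      refine eq_empty_of_forall_notMem fun i hi => hi.2 ?_
      rw [Bool.eq_iff_iff, hf i hi.1.1 t, point_apply, show f i = n from hi.1.2]

end SplitSpace

end Space

/-! ### The recursion of length ω₁ -/

open Cardinal in
/-- The main construction: under the continuum hypothesis there is a non-compact Hausdorff space
that distinguishes `BW(I)` from `BW(J)`, as soon as there is a notion of a good restriction of a
map `ℕ → ℕ` with the stated properties. -/
theorem exists_space_hasBW_not_hasBW (CH : continuum.{0} = aleph.{0} 1)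
    {I J : Set (Set ℕ)} (hI : IsSetIdeal I) (hP : IsPPlus I) (hJ : IsSetIdeal J)
    (Good : (ℕ → ℕ) → Set ℕ → Prop) (good_empty : ∀ f, Good f ∅)
    (exists_good : ∀ (f : ℕ → ℕ) (B : Set ℕ), B ∉ I → (∀ n, B ∩ f ⁻¹' {n} ∈ I) →
      ∃ C ⊆ B, C ∉ I ∧ Good f C)
    (exists_split : ∀ (f : ℕ → ℕ → ℕ) (C : ℕ → Set ℕ), (∀ k, Good (f k) (C k)) → ∀ B ∉ J,
      ∃ S ⊆ B, S ∉ J ∧ B \ S ∉ J ∧ ∀ k, C k ∩ f k ⁻¹' S ∈ I) :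
    ∃ (X : Type) (_ : TopologicalSpace X),
      T2Space X ∧ HasBW I X ∧ ¬ CompactSpace X ∧ ¬ HasBW J X := by
  let T := (ℕ → ℕ) × Set ℕ × Set ℕ
  have hT : #T = continuum := by
    simp [T, mk_set]
  have : Uncountable T := by
    rw [← aleph0_lt_mk_iff, hT]
    exact aleph0_lt_continuum
  obtain ⟨r, hr, hcount⟩ := exists_wellOrder_countable_initial (hT.trans CH)
  obtain ⟨g, hg⟩ := WellFounded.exists_forall_rel (α := Set ℕ × Set ℕ) hr.wf
    -- Here t = (f, B, B') and a = (S, C): S splits B', while C ⊆ B handles the map f.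
    (fun t a => (t.2.2 ∉ J → a.1 ⊆ t.2.2 ∧ a.1 ∉ J ∧ t.2.2 \ a.1 ∉ J) ∧ Good t.1 a.2 ∧
      ((t.2.1 ∉ I ∧ ∀ n, t.2.1 ∩ t.1 ⁻¹' {n} ∈ I) → a.2 ⊆ t.2.1 ∧ a.2 ∉ I) ∧
      (a.2 ∩ t.1 ⁻¹' a.1 ∈ I ∨ a.2 \ t.1 ⁻¹' a.1 ∈ I))
    (fun s b t a => b.2 ∩ s.1 ⁻¹' a.1 ∈ I ∧ (a.2 ∩ t.1 ⁻¹' b.1 ∈ I ∨ a.2 \ t.1 ⁻¹' b.1 ∈ I))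
    (by
      rintro ⟨f, B, B'⟩ g hg
      have hS : ∃ S : Set ℕ, (B' ∉ J → S ⊆ B' ∧ S ∉ J ∧ B' \ S ∉ J) ∧
          ∀ s, r s (f, B, B') → (g s).2 ∩ s.1 ⁻¹' S ∈ I := by
        by_cases hB' : B' ∈ J
        · exact ⟨∅, fun h => (h hB').elim, fun s _ => by simpa using hI.empty⟩
        -- Adding the harmless pair (f, ∅) makes the countable set of earlier tasks nonempty, hence
        -- the range of a sequence.
        obtain ⟨e, he⟩ := ((hcount (f, B, B')).image fun s => (s.1, (g s).2)).insert (f, ∅)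
          |>.exists_eq_range (insert_nonempty _ _)
        obtain ⟨S, hSB, hS, hS', hC⟩ := exists_split (fun k => (e k).1) (fun k => (e k).2)
          (fun k => by
            rcases he ▸ mem_range_self k with h | ⟨s, hs, h⟩
            · rw [h]
              exact good_empty f
            · rw [← h]
              exact (hg s hs).2.1) B' hB'
        refine ⟨S, fun _ => ⟨hSB, hS, hS'⟩, fun s hs => ?_⟩
        have : (s.1, (g s).2) ∈ range e := he ▸ mem_insert_of_mem _ (mem_image_of_mem _ hs)
        obtain ⟨k, hk⟩ := this
        simpa only [hk] using hC k
      obtain ⟨S, hS, hR⟩ := hS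
      by_cases hB : B ∉ I ∧ ∀ n, B ∩ f ⁻¹' {n} ∈ I
      · have := (hcount (f, B, B')).to_subtype
        obtain ⟨C', hC'B, hC', hdec⟩ := hP.exists_decided hI hB.1
          -- `none` stands for the new set S, `some s` for the earlier ones.
          fun o : Option {s | r s (f, B, B')} => f ⁻¹' (o.elim S fun s => (g s).1)
        obtain ⟨C, hCC', hC, hgood⟩ := exists_good f C' hC' fun n =>
          hI.mono (inter_subset_inter_left _ hC'B) (hB.2 n)
        have hdec' := fun o => (hdec o).imp
          (fun h => hI.mono (inter_subset_inter_left _ hCC') (hI.finite h))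
          (fun h => hI.mono (sdiff_subset_sdiff_left hCC') (hI.finite h))
        exact ⟨(S, C), ⟨hS, hgood, fun _ => ⟨hCC'.trans hC'B, hC⟩, hdec' none⟩,
          fun s hs => ⟨hR s hs, hdec' (some ⟨s, hs⟩)⟩⟩
      · refine ⟨(S, ∅), ⟨hS, good_empty f, fun h => (hB h).elim, Or.inl ?_⟩,
          fun s hs => ⟨hR s hs, Or.inl ?_⟩⟩ <;> simpa using hI.empty)
  have hsplit : ∀ B ∉ J, ∃ t, (g t).1 ⊆ B ∧ (g t).1 ∉ J ∧ B \ (g t).1 ∉ J :=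
    fun B hB => ⟨(id, B, B), (hg (id, B, B)).1.1 hB⟩
  refine ⟨SplitSpace fun t => (g t).1, inferInstance, inferInstance,
    SplitSpace.hasBW hI hP fun f B hB hfib => ?_, SplitSpace.not_compactSpace fun n => ?_,
    SplitSpace.not_hasBW hsplit⟩
  · have ht := hg (f, B, ∅)
    obtain ⟨hCB, hC⟩ := ht.1.2.2.1 ⟨hB, hfib⟩
    refine ⟨_, hCB, hC, insert (f, B, ∅) {s | r s (f, B, ∅)}, (hcount _).insert _, ?_, ?_⟩
    · rintro s (rfl | hs)
      exacts [ht.1.2.2.2, (ht.2 s hs).2]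
    · intro s hs
      rw [mem_insert_iff, not_or] at hs
      rcases trichotomous_of r (f, B, ∅) s with h | h | h
      exacts [((hg s).2 _ h).1, (hs.1 h.symm).elim, (hs.2 h).elim]
  · obtain ⟨t, ht, -⟩ := hsplit (univ \ {n}) (hJ.diff_not_mem hJ.univ (hJ.finite (finite_singleton n)))
    exact ⟨t, fun h => (ht h).2 rfl⟩

/-! ### Finite witnesses of positivity -/

/-- A sequence of finite sets in which each term is chosen depending on the union of the previous
ones. -/
theorem exists_seq_finset {Q : ℕ → Finset ℕ → Finset ℕ → Prop} (h : ∀ j G, ∃ L, Q j G L) :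
    ∃ L : ℕ → Finset ℕ, ∀ j, Q j ((Finset.range j).biUnion L) (L j) := by
  classical
  choose F hF using h
  let G : ℕ → Finset ℕ := fun n => Nat.rec ∅ (fun j G => G ∪ F j G) n
  have hG : ∀ j, G j = (Finset.range j).biUnion fun i => F i (G i) := fun j => by
    induction j with
    | zero => rfl
    | succ j ih =>
      rw [Finset.range_add_one, Finset.biUnion_insert, ← ih, Finset.union_comm]
  exact ⟨fun j => F j (G j), fun j => hG j ▸ hF j (G j)⟩

/-- The family `I` is described by finite witnesses of positivity: `Big j L` says that `L` witnesses
positivity to degree `j`. -/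
structure HasWitnesses (I : Set (Set ℕ)) (Big : ℕ → Finset ℕ → Prop) : Prop where
  exists_big : ∀ A ∉ I, ∀ j, ∃ L : Finset ℕ, ↑L ⊆ A ∧ Big j L
  not_mem : ∀ L : ℕ → Finset ℕ, (∀ i j, i < j → Disjoint (L i) (L j)) → (∀ j, Big j (L j)) →
    ∀ E : Set ℕ, E.Infinite → (⋃ j ∈ E, (L j : Set ℕ)) ∉ I

namespace HasWitnesses

variable {I : Set (Set ℕ)} {Big : ℕ → Finset ℕ → Prop}

theorem exists_seq (hW : HasWitnesses I Big) (hI : IsSetIdeal I) {B : ℕ → Set ℕ}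
    (hB : ∀ j, B j ∉ I) :
    ∃ L : ℕ → Finset ℕ, (∀ i j, i < j → Disjoint (L i) (L j)) ∧ (∀ j, ↑(L j) ⊆ B j) ∧
      ∀ j, Big j (L j) := by
  obtain ⟨L, hL⟩ := exists_seq_finset
    (Q := fun j G L => Disjoint G L ∧ ↑L ⊆ B j ∧ Big j L) fun j G => by
      obtain ⟨L, hLB, hL⟩ := hW.exists_big _ (hI.diff_not_mem (hB j) (hI.finite G.finite_toSet)) j
      refine ⟨L, ?_, hLB.trans sdiff_subset, hL⟩
      rw [Finset.disjoint_right]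
      exact fun x hx hxG => (hLB hx).2 hxG
  refine ⟨L, fun i j hij => ?_, fun j => (hL j).2.1, fun j => (hL j).2.2⟩
  exact (hL j).1.mono_left (Finset.subset_biUnion_of_mem L (Finset.mem_range.2 hij))

/-- Take the union of disjoint witnesses L j ⊆ B j: outside B j it has only points of the first j
witnesses. -/
theorem isPPlus (hW : HasWitnesses I Big) (hI : IsSetIdeal I) : IsPPlus I := by
  intro B hanti hB
  obtain ⟨L, hdis, hLB, hL⟩ := hW.exists_seq hI hB
  refine ⟨_, iUnion₂_subset fun j _ => (hLB j).trans (hanti (Nat.zero_le j)),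
    hW.not_mem L hdis hL univ infinite_univ, fun j => ?_⟩
  refine ((Finset.range j).biUnion L).finite_toSet.subset fun x hx => ?_
  obtain ⟨i, -, hi⟩ := mem_iUnion₂.1 hx.1
  simp only [Finset.mem_coe, Finset.mem_biUnion, Finset.mem_range]
  exact ⟨i, lt_of_not_ge fun h => hx.2 (hanti h (hLB i hi)), hi⟩

/-- The even-indexed witnesses form a positive set with positive complement. -/
theorem exists_split (hW : HasWitnesses I Big) (hI : IsSetIdeal I) {B : ℕ → Set ℕ}
    (hB : ∀ j, B j ∉ I) {A : Set ℕ} (hBA : ∀ j, B j ⊆ A) :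
    ∃ L : ℕ → Finset ℕ, (∀ j, ↑(L j) ⊆ B j) ∧ (∀ j, Big j (L j)) ∧
      ∃ S ⊆ A, S ∉ I ∧ A \ S ∉ I ∧ S ⊆ ⋃ j, (L j : Set ℕ) := by
  obtain ⟨L, hdis, hLB, hL⟩ := hW.exists_seq hI hB
  have hdis' : ∀ i j, i ≠ j → Disjoint (L i) (L j) := fun i j hij =>
    hij.lt_or_gt.elim (hdis i j) fun h => (hdis j i h).symm
  have heven : {j : ℕ | Even j}.Infinite :=
    infinite_of_injective_forall_mem (f := fun n => 2 * n) (mul_right_injective₀ two_ne_zero)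
      fun n => even_two_mul n
  have hodd : {j : ℕ | Odd j}.Infinite :=
    infinite_of_injective_forall_mem (f := fun n => 2 * n + 1)
      ((add_left_injective 1).comp (mul_right_injective₀ two_ne_zero)) fun n => odd_two_mul_add_one n
  refine ⟨L, hLB, hL, ⋃ j ∈ {j : ℕ | Even j}, (L j : Set ℕ),
    iUnion₂_subset fun j _ => (hLB j).trans (hBA j),
    hW.not_mem L hdis hL _ heven, fun h => ?_,
    iUnion₂_subset fun j _ => subset_iUnion (fun j => (L j : Set ℕ)) j⟩
  refine hW.not_mem L hdis hL _ hodd (hI.mono ?_ h)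
  refine iUnion₂_subset fun j hj x hx => ⟨hBA j (hLB j hx), fun hxe => ?_⟩
  obtain ⟨i, hi, hxi⟩ := mem_iUnion₂.1 hxe
  refine Finset.disjoint_left.1 (hdis' i j ?_) hxi hx
  rintro rfl
  exact Nat.not_even_iff_odd.2 hj hi

end HasWitnesses

/-- If every `I`-to-one map sends some positive set into `J`, then `I` and `J` can be
distinguished. -/
theorem exists_space_of_image_mem (CH : Cardinal.continuum.{0} = Cardinal.aleph.{0} 1)
    {I J : Set (Set ℕ)} (hI : IsSetIdeal I) {BigI BigJ : ℕ → Finset ℕ → Prop}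
    (hWI : HasWitnesses I BigI) (hJ : IsSetIdeal J) (hWJ : HasWitnesses J BigJ)
    (h : ∀ (f : ℕ → ℕ) (B : Set ℕ), B ∉ I → (∀ n, B ∩ f ⁻¹' {n} ∈ I) →
      ∃ C ⊆ B, C ∉ I ∧ f '' C ∈ J) :
    ∃ (X : Type) (_ : TopologicalSpace X),
      T2Space X ∧ HasBW I X ∧ ¬ CompactSpace X ∧ ¬ HasBW J X := by
  refine exists_space_hasBW_not_hasBW CH hI (hWI.isPPlus hI) hJ
    (fun f C => f '' C ∈ J ∧ ∀ n, C ∩ f ⁻¹' {n} ∈ I)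
    (fun f => by simpa using ⟨hJ.empty, hI.empty⟩) (fun f B hB hfib => ?_) fun f C hC B hB => ?_
  · obtain ⟨C, hCB, hC, hCJ⟩ := h f B hB hfib
    exact ⟨C, hCB, hC, hCJ, fun n => hI.mono (inter_subset_inter_left _ hCB) (hfib n)⟩
  · obtain ⟨L, hL, -, S, hSB, hS, hS', hSL⟩ := hWJ.exists_split hJ
      (B := fun j => B \ ⋃ k ∈ {k | k < j}, f k '' C k)
      (fun j => hJ.diff_not_mem hB (hJ.biUnion (finite_lt_nat j) fun k _ => (hC k).1))
      (fun j => sdiff_subset)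
    refine ⟨S, hSB, hS, hS', fun k => ?_⟩
    -- Only the blocks 0, …, k can meet f_k[C_k], so finitely many fibres of f_k cover the set.
    refine hI.mono ?_ (hI.biUnion ((Finset.range (k + 1)).biUnion L).finite_toSet
      fun n _ => (hC k).2 n)
    rintro x ⟨hxC, hxS⟩
    obtain ⟨j, hj⟩ := mem_iUnion.1 (hSL hxS)
    refine mem_iUnion₂.2 ⟨f k x, ?_, hxC, rfl⟩
    simp only [Finset.mem_coe, Finset.mem_biUnion, Finset.mem_range]
    refine ⟨j, lt_of_not_ge fun hkj => (hL j hj).2 ?_, hj⟩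
    exact mem_iUnion₂.2 ⟨k, hkj, mem_image_of_mem _ hxC⟩

/-! ### Sequential compactness as BW of the finite ideal -/

section SequentialCompactness

variable {X : Type*} [TopologicalSpace X]

theorem HasBW.seqCompactSpace (h : HasBW finiteIdeal X) : SeqCompactSpace X := by
  refine ⟨fun x _ => ?_⟩
  obtain ⟨A, hA, p, hp⟩ := h x
  have hA : (Set.ofPred (· ∈ A)).Infinite := hA
  refine ⟨p, mem_univ _, Nat.nth (· ∈ A), Nat.nth_strictMono hA, ?_⟩
  rw [tendsto_nhds]
  intro U hU hpU
  have hfin : {n | n ∈ A ∧ x n ∉ U}.Finite := hp U hU hpU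
  have h1 := (Nat.nth_strictMono hA).tendsto_atTop.eventually
    (Nat.cofinite_eq_atTop ▸ hfin.compl_mem_cofinite : ∀ᶠ n in atTop, n ∈ {n | n ∈ A ∧ x n ∉ U}ᶜ)
  filter_upwards [h1] with k hk
  by_contra hkU
  exact hk ⟨Nat.nth_mem_of_infinite hA k, hkU⟩

theorem HasBW.of_seqCompactSpace [SeqCompactSpace X] : HasBW finiteIdeal X := by
  intro x
  obtain ⟨p, φ, hφ, hp⟩ := SeqCompactSpace.tendsto_subseq x
  refine ⟨range φ, infinite_range_of_injective hφ.injective, p, fun U hU hpU => ?_⟩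
  have := hp.eventually (hU.mem_nhds hpU)
  rw [← Nat.cofinite_eq_atTop, eventually_cofinite] at this
  refine (this.image φ).subset ?_
  rintro _ ⟨⟨k, rfl⟩, hk⟩
  exact mem_image_of_mem _ hk

end SequentialCompactness

/-- Witnesses for the ideal of finite sets. -/
theorem hasWitnesses_finiteIdeal :
    HasWitnesses finiteIdeal fun j L => L.Nonempty ∧ L.card ≤ j + 1 where
  exists_big A hA j := by
    obtain ⟨n, hn⟩ := Set.Infinite.nonempty hA
    exact ⟨{n}, by simpa using hn, by simp, by simp⟩
  not_mem L hdis hL E hE h := by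
    choose a ha using fun j => (hL j).1
    have hinj : Function.Injective a := fun i j hij => by
      by_contra hne
      rcases lt_or_gt_of_ne hne with hlt | hlt
      · exact Finset.disjoint_left.1 (hdis i j hlt) (ha i) (hij ▸ ha j)
      · exact Finset.disjoint_left.1 (hdis j i hlt) (ha j) (hij ▸ ha i)
    refine hE.image hinj.injOn (Set.Finite.subset h ?_)
    rintro _ ⟨j, hj, rfl⟩
    exact mem_iUnion₂.2 ⟨j, hj, ha j⟩

/-! ### The van der Waerden ideal -/

section VanDerWaerden

theorem ContainsAP.mono {A B : Set ℕ} {n m : ℕ} (h : ContainsAP A n) (hAB : A ⊆ B) (hmn : m ≤ n) :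
    ContainsAP B m := by
  obtain ⟨a, d, hd, h⟩ := h
  exact ⟨a, d, hd, fun i hi => hAB (h i (hi.trans_le hmn))⟩

theorem notMem_vanDerWaerdenIdeal {A : Set ℕ} :
    A ∉ vanDerWaerdenIdeal ↔ ∀ n, ContainsAP A n := by
  simp [vanDerWaerdenIdeal]

/-- Van der Waerden's theorem for two colors, finite form. -/
theorem exists_containsAP_of_union (n : ℕ) : ∃ N, ∀ A B : Set ℕ, ContainsAP (A ∪ B) N →
    ContainsAP A n ∨ ContainsAP B n := by
  classical
  -- Hales–Jewett over the alphabet {0, …, n}: sending a word v to a + (∑ v i) d turns a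
  -- combinatorial line into a progression whose difference is d times the number of active
  -- coordinates.
  obtain ⟨ι, _, hι⟩ := Combinatorics.Line.exists_mono_in_high_dimension (Fin (n + 1)) Bool
  refine ⟨n * Fintype.card ι + 1, fun A B ⟨a, d, hd, h⟩ => ?_⟩
  obtain ⟨l, c, hc⟩ := hι fun v => decide (a + (∑ i, (v i : ℕ)) * d ∈ A)
  set K := Finset.univ.filter fun i => l.idxFun i = none with hK
  set b := ∑ i ∈ Finset.univ.filter (fun i => l.idxFun i ≠ none), (l 0 i : ℕ) with hb
  have hsum : ∀ x : Fin (n + 1), ∑ i, (l x i : ℕ) = K.card * x + b := fun x => by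
    rw [← Finset.sum_filter_add_sum_filter_not Finset.univ (fun i => l.idxFun i = none)]
    congr 1
    · rw [Finset.sum_congr rfl (g := fun _ => (x : ℕ)), Finset.sum_const, smul_eq_mul]
      intro i hi
      rw [Finset.mem_filter] at hi
      rw [Combinatorics.Line.apply_none _ _ _ hi.2]
    · refine Finset.sum_congr rfl fun i hi => ?_
      obtain ⟨y, hy⟩ := Option.ne_none_iff_exists'.1 (Finset.mem_filter.1 hi).2
      simp [hy]
  have hKpos : 0 < K.card := by
    obtain ⟨i, hi⟩ := l.proper
    exact Finset.card_pos.2 ⟨i, by simp [hK, hi]⟩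
  have hmem : ∀ x : Fin (n + 1), a + (∑ i, (l x i : ℕ)) * d ∈ A ∪ B := fun x => by
    refine h _ (Nat.lt_succ_of_le ((Finset.sum_le_card_nsmul _ _ n fun i _ => ?_).trans ?_))
    · exact Nat.lt_succ_iff.1 (l x i).2
    · simp [mul_comm]
  have hap : ∀ C : Set ℕ, (∀ x : Fin (n + 1), a + (∑ i, (l x i : ℕ)) * d ∈ C) →
      ContainsAP C n := fun C hC =>
    ⟨a + b * d, K.card * d, Nat.mul_pos hKpos hd, fun i hi => by
      have := hC ⟨i, hi.trans n.lt_succ_self⟩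
      rw [hsum] at this
      convert this using 1
      simp only
      ring⟩
  cases c
  · right
    refine hap B fun x => (hmem x).resolve_left ?_
    exact of_decide_eq_false (hc x)
  · left
    exact hap A fun x => of_decide_eq_true (hc x)

theorem isSetIdeal_vanDerWaerdenIdeal : IsSetIdeal vanDerWaerdenIdeal where
  mono h := fun ⟨n, hn⟩ => ⟨n, fun hA => hn (hA.mono h le_rfl)⟩
  union := by
    rintro A B ⟨n, hn⟩ ⟨m, hm⟩
    obtain ⟨N, hN⟩ := exists_containsAP_of_union (max n m)
    refine ⟨N, fun h => ?_⟩
    rcases hN A B h with h | h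
    exacts [hn (h.mono Subset.rfl (le_max_left _ _)), hm (h.mono Subset.rfl (le_max_right _ _))]
  finite := by
    intro A hA
    obtain ⟨N, hN⟩ := hA.bddAbove
    refine ⟨N + 2, fun ⟨a, d, hd, h⟩ => ?_⟩
    have h1 := hN (h (N + 1) (by lia))
    nlinarith
  univ := notMem_vanDerWaerdenIdeal.2 fun n => ⟨0, 1, one_pos, fun _ _ => mem_univ _⟩

/-- The cardinality bound is what the arguments with the summable ideal need: j points suffice for a
progression of length j. -/
theorem hasWitnesses_vanDerWaerdenIdeal :
    HasWitnesses vanDerWaerdenIdeal fun j L => ContainsAP L j ∧ L.card ≤ j + 1 where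
  exists_big A hA j := by
    obtain ⟨a, d, hd, h⟩ := notMem_vanDerWaerdenIdeal.1 hA j
    refine ⟨(Finset.range j).image fun i => a + i * d, ?_, ⟨a, d, hd, fun i hi => ?_⟩, ?_⟩
    · intro x hx
      simp only [Finset.coe_image, Finset.coe_range, mem_image, mem_Iio] at hx
      obtain ⟨i, hi, rfl⟩ := hx
      exact h i hi
    · exact Finset.mem_coe.2 (Finset.mem_image_of_mem _ (Finset.mem_range.2 hi))
    · exact Finset.card_image_le.trans (by simp)
  not_mem L _ hL E hE := notMem_vanDerWaerdenIdeal.2 fun n => by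
    obtain ⟨j, hj, hnj⟩ := hE.exists_gt n
    exact (hL j).1.mono (subset_biUnion_of_mem (u := fun j => (L j : Set ℕ)) hj) hnj.le

/-- An infinite set is mapped by a finite-to-one map onto a set with an infinite subset containing
no arithmetic progression of length `3`. -/
theorem exists_infinite_image_mem_vanDerWaerdenIdeal (f : ℕ → ℕ) (B : Set ℕ) (hB : B ∉ finiteIdeal)
    (hfib : ∀ n, B ∩ f ⁻¹' {n} ∈ finiteIdeal) :
    ∃ C ⊆ B, C ∉ finiteIdeal ∧ f '' C ∈ vanDerWaerdenIdeal := by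
  obtain ⟨L, hL⟩ := exists_seq_finset
    (Q := fun _ G L => ∃ b ∈ B, L = {b} ∧ ∀ g ∈ G, 2 * f g < f b) fun j G => by
      obtain ⟨N, hN⟩ := (G.image fun g => 2 * f g).bddAbove
      have := isSetIdeal_finiteIdeal.diff_not_mem hB
        (isSetIdeal_finiteIdeal.biUnion (finite_le_nat N) fun n _ => hfib n)
      obtain ⟨b, hb, hb'⟩ := Set.Infinite.nonempty this
      refine ⟨{b}, b, hb, rfl, fun g hg => lt_of_le_of_lt
        (hN (Finset.mem_coe.2 (Finset.mem_image_of_mem _ hg))) (lt_of_not_ge fun h => hb' ?_)⟩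
      exact mem_iUnion₂.2 ⟨f b, h, hb, rfl⟩
  choose b hbB hLb hlt using hL
  have hb : ∀ i j, i < j → 2 * f (b i) < f (b j) := fun i j hij =>
    hlt j _ (Finset.mem_biUnion.2 ⟨i, Finset.mem_range.2 hij, by simp [hLb i]⟩)
  have hmono : StrictMono fun i => f (b i) := fun i j hij => by
    have := hb i j hij
    simp only
    lia
  refine ⟨range b, range_subset_iff.2 hbB, infinite_range_of_injective
    (hmono.injective.of_comp (f := f)), 3, fun ⟨a, d, hd, h⟩ => ?_⟩
  -- The last two terms a + d and a + 2d already contradict 2 f (b i) < f (b j).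
  obtain ⟨_, ⟨i, rfl⟩, hi⟩ := h 1 (by norm_num)
  obtain ⟨_, ⟨j, rfl⟩, hj⟩ := h 2 (by norm_num)
  have hij : i < j := hmono.lt_iff_lt.1 (by lia)
  have := hb i j hij
  lia

end VanDerWaerden

/-! ### The summable ideal as the sets of finite harmonic mass -/

section Summable

open MeasureTheory ENNReal

/-- The measure on `ℕ` giving mass `1 / (n + 1)` to the point `n`. -/
noncomputable def harmonicMeasure : Measure ℕ :=
  Measure.sum fun n : ℕ => ENNReal.ofReal (1 / ((n : ℝ) + 1)) • Measure.dirac n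

theorem harmonicMeasure_apply (A : Set ℕ) :
    harmonicMeasure A = ∑' n : ℕ, A.indicator (fun n => ENNReal.ofReal (1 / ((n : ℝ) + 1))) n := by
  rw [harmonicMeasure, Measure.sum_apply _ (MeasurableSet.of_discrete)]
  congr 1
  ext n
  by_cases hn : n ∈ A <;> simp [hn]

theorem harmonicMeasure_singleton (n : ℕ) :
    harmonicMeasure {n} = ENNReal.ofReal (1 / ((n : ℝ) + 1)) := by
  rw [harmonicMeasure_apply, tsum_eq_single n]
  · simp
  · intro m hm
    simp [hm]

theorem mem_summableIdeal {A : Set ℕ} : A ∈ summableIdeal ↔ harmonicMeasure A ≠ ∞ := by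
  have h : (fun n : ℕ => A.indicator (fun n => ENNReal.ofReal (1 / ((n : ℝ) + 1))) n) =
      fun n => ENNReal.ofReal (A.indicator (fun n : ℕ => 1 / ((n : ℝ) + 1)) n) := by
    ext n
    by_cases hn : n ∈ A <;> simp [hn]
  have hnn : ∀ n : ℕ, 0 ≤ A.indicator (fun n : ℕ => 1 / ((n : ℝ) + 1)) n :=
    indicator_nonneg fun n _ => by positivity
  have h1 : A ∈ summableIdeal ↔ Summable (A.indicator fun n : ℕ => 1 / ((n : ℝ) + 1)) :=
    summable_subtype_iff_indicator (f := fun n : ℕ => 1 / ((n : ℝ) + 1))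
  rw [h1, harmonicMeasure_apply, h]
  refine ⟨fun hs => hs.tsum_ofReal_ne_top, fun hs => ?_⟩
  have := ENNReal.summable_toReal hs
  simpa only [ENNReal.toReal_ofReal (hnn _)] using this

theorem notMem_summableIdeal {A : Set ℕ} : A ∉ summableIdeal ↔ harmonicMeasure A = ∞ := by
  rw [mem_summableIdeal, not_not]

theorem tsum_one_div_eq_top : ∑' n : ℕ, ENNReal.ofReal (1 / ((n : ℝ) + 1)) = ∞ := by
  by_contra h
  have := ENNReal.summable_toReal h
  have h2 : Summable fun n : ℕ => 1 / ((n : ℝ) + 1) := by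
    convert this using 2 with n
    rw [ENNReal.toReal_ofReal (by positivity)]
  refine Real.not_summable_one_div_natCast ((summable_nat_add_iff 1).1 ?_)
  simpa using h2

theorem isSetIdeal_summableIdeal : IsSetIdeal summableIdeal where
  mono h := by
    simp only [mem_summableIdeal]
    exact fun hB hA => hB (top_le_iff.1 (hA ▸ measure_mono h))
  union := by
    simp only [mem_summableIdeal]
    exact fun hA hB => measure_union_ne_top hA hB
  finite := by
    intro A hA
    induction A, hA using Set.Finite.induction_on with
    | empty => simp [mem_summableIdeal]
    | @insert n A _ _ ih =>
      rw [mem_summableIdeal] at ih ⊢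
      rw [insert_eq]
      exact measure_union_ne_top (by simp [harmonicMeasure_singleton]) ih
  univ := by
    rw [notMem_summableIdeal, harmonicMeasure_apply]
    simpa using tsum_one_div_eq_top

/-- A set of infinite mass has finite subsets of large mass, with control of the last point. -/
theorem exists_finset_harmonicMeasure {A : Set ℕ} (hA : A ∉ summableIdeal) {c : ℝ≥0∞} (hc : c ≠ ∞)
    (hc0 : c ≠ 0) :
    ∃ (L : Finset ℕ), ↑L ⊆ A ∧ c ≤ harmonicMeasure L ∧
      ∃ m ∈ A, harmonicMeasure L ≤ c + harmonicMeasure {m} := by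
  have hmono : Monotone fun n => A ∩ Iio n := fun n m h =>
    inter_subset_inter_right _ (Iio_subset_Iio h)
  have hU : ⋃ n, A ∩ Iio n = A := by
    ext x
    simp only [mem_iUnion, mem_inter_iff, mem_Iio]
    exact ⟨fun ⟨_, h, _⟩ => h, fun h => ⟨x + 1, h, x.lt_succ_self⟩⟩
  have hlim := tendsto_measure_iUnion_atTop (μ := harmonicMeasure) hmono
  rw [hU, notMem_summableIdeal.1 hA] at hlim
  have hex : ∃ n, c ≤ harmonicMeasure (A ∩ Iio n) :=
    ((hlim.eventually (lt_mem_nhds hc.lt_top)).exists).imp fun _ h => le_of_lt h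
  -- The least initial segment of mass at least c overshoots c by at most the mass of its last point
  -- m.
  classical
  have hfin : (A ∩ Iio (Nat.find hex)).Finite := (finite_Iio _).subset inter_subset_right
  have hspec := Nat.find_spec hex
  obtain ⟨m, hm⟩ : ∃ m, Nat.find hex = m + 1 := Nat.exists_eq_succ_of_ne_zero fun h0 => by
    rw [h0] at hspec
    simp [hc0] at hspec
  have hlt : harmonicMeasure (A ∩ Iio m) < c := not_le.1 (Nat.find_min hex (by lia))
  refine ⟨hfin.toFinset, by simp, by simpa using hspec, m, ?_, ?_⟩
  · by_contra hmA
    refine hlt.not_ge (hspec.trans (measure_mono fun x hx => ⟨hx.1, ?_⟩))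
    have h1 : x < Nat.find hex := hx.2
    have h2 : x ≠ m := fun h => hmA (h ▸ hx.1)
    exact mem_Iio.2 (by lia)
  · rw [hfin.coe_toFinset]
    refine (measure_mono (t := A ∩ Iio m ∪ {m}) fun x hx => ?_).trans
      ((measure_union_le _ _).trans (add_le_add_left hlt.le _))
    have h1 : x < Nat.find hex := hx.2
    by_cases h2 : x = m
    · exact Or.inr h2
    · exact Or.inl ⟨hx.1, mem_Iio.2 (by lia)⟩

theorem harmonicMeasure_biUnion {L : ℕ → Finset ℕ} (h : ∀ i j, i < j → Disjoint (L i) (L j))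
    (E : Set ℕ) :
    harmonicMeasure (⋃ j ∈ E, (L j : Set ℕ)) = ∑' j : E, harmonicMeasure (L j) := by
  refine measure_biUnion (to_countable E) (fun i _ j _ hij => ?_) fun _ _ => .of_discrete
  rw [Function.onFun, Finset.disjoint_coe]
  exact hij.lt_or_gt.elim (h i j) fun h' => (h j i h').symm

theorem hasWitnesses_summableIdeal :
    HasWitnesses summableIdeal fun _ L => 1 ≤ harmonicMeasure L where
  exists_big A hA _ := by
    obtain ⟨L, hLA, hL, -⟩ := exists_finset_harmonicMeasure hA one_ne_top one_ne_zero
    exact ⟨L, hLA, hL⟩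
  not_mem L hdis hL E hE := by
    have := hE.to_subtype
    rw [notMem_summableIdeal, harmonicMeasure_biUnion hdis]
    refine top_le_iff.1 (le_trans (le_of_eq ?_) (ENNReal.tsum_le_tsum fun j : E => hL j))
    exact (ENNReal.tsum_const_eq_top_of_ne_zero one_ne_zero).symm

theorem ENNReal.tsum_card_mul_ne_top : ∑' j : ℕ, ((j : ℝ≥0∞) + 1) * ENNReal.ofReal (1 / 2 ^ j) ≠ ∞ := by
  have h : Summable fun j : ℕ => ((j : ℝ) + 1) * (1 / 2) ^ j := by
    have h1 := summable_pow_mul_geometric_of_norm_lt_one (R := ℝ) 1 (r := 1 / 2) (by norm_num)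
    have h0 := summable_pow_mul_geometric_of_norm_lt_one (R := ℝ) 0 (r := 1 / 2) (by norm_num)
    refine (h1.add h0).congr fun j => ?_
    ring
  convert h.tsum_ofReal_ne_top using 3 with j
  rw [ENNReal.ofReal_mul (by positivity), ENNReal.ofReal_add (by positivity) one_pos.le]
  simp

/-- If positivity for `I` is witnessed by small finite sets, then every `I`-to-one map sends some
`I`-positive set into the summable ideal. -/
theorem HasWitnesses.exists_image_mem_summableIdeal {I : Set (Set ℕ)} (hI : IsSetIdeal I)
    {Big : ℕ → Finset ℕ → Prop} (hW : HasWitnesses I Big)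
    (hcard : ∀ j L, Big j L → L.card ≤ j + 1) (f : ℕ → ℕ) (B : Set ℕ) (hB : B ∉ I)
    (hfib : ∀ n, B ∩ f ⁻¹' {n} ∈ I) :
    ∃ C ⊆ B, C ∉ I ∧ f '' C ∈ summableIdeal := by
  -- With the fibres over n < 2^j removed, f is at least 2^j on the at most j + 1 points of L j, so
  -- the images have total mass at most ∑ (j + 1) 2⁻ʲ.
  obtain ⟨L, hdis, hLB, hL⟩ := hW.exists_seq hI
    (B := fun j => B \ ⋃ n ∈ {n | n < 2 ^ j}, B ∩ f ⁻¹' {n})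
    fun j => hI.diff_not_mem hB (hI.biUnion (finite_lt_nat _) fun n _ => hfib n)
  have hC := hW.not_mem L hdis hL univ infinite_univ
  simp only [mem_univ, iUnion_true] at hC
  refine ⟨_, iUnion_subset fun j => (hLB j).trans sdiff_subset, hC, ?_⟩
  rw [mem_summableIdeal, image_iUnion]
  refine ne_top_of_le_ne_top ENNReal.tsum_card_mul_ne_top
    ((measure_iUnion_le _).trans (ENNReal.tsum_le_tsum fun j => ?_))
  have hunion : f '' (L j : Set ℕ) = ⋃ x ∈ L j, {f x} := by
    ext y
    simp [eq_comm]
  rw [hunion]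
  refine (measure_biUnion_finset_le _ _).trans
    ((Finset.sum_le_card_nsmul _ _ (ENNReal.ofReal (1 / 2 ^ j)) fun x hx => ?_).trans ?_)
  · rw [harmonicMeasure_singleton]
    refine ENNReal.ofReal_le_ofReal (one_div_le_one_div_of_le (by positivity) ?_)
    have h2 : 2 ^ j ≤ f x := le_of_not_gt fun h =>
      (hLB j hx).2 (mem_iUnion₂.2 ⟨f x, h, (hLB j hx).1, rfl⟩)
    have h3 : (2 : ℝ) ^ j ≤ f x := by exact_mod_cast h2
    linarith
  · rw [nsmul_eq_mul]
    gcongr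
    exact_mod_cast hcard j _ (hL j)

/-- The fibers of `f` on `C` have mass tending to zero. -/
def HasVanishingFibers (f : ℕ → ℕ) (C : Set ℕ) : Prop :=
  (∀ n, harmonicMeasure (C ∩ f ⁻¹' {n}) ≠ ∞) ∧
    Tendsto (fun n => harmonicMeasure (C ∩ f ⁻¹' {n})) atTop (𝓝 0)

theorem exists_hasVanishingFibers (f : ℕ → ℕ) (B : Set ℕ) (hB : B ∉ summableIdeal)
    (hfib : ∀ n, B ∩ f ⁻¹' {n} ∈ summableIdeal) :
    ∃ C ⊆ B, C ∉ summableIdeal ∧ HasVanishingFibers f C := by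
  have hI := isSetIdeal_summableIdeal
  -- Blocks of mass between 1/(j+1) and 2/(j+1) have divergent total mass, yet each fibre meets only
  -- one block, so fibre masses vanish. Discarding the points below j keeps the overshoot at most
  -- 1/(j+1).
  obtain ⟨L, hL⟩ := exists_seq_finset (Q := fun j G L => ↑L ⊆ B ∧ (∀ g ∈ G, ∀ x ∈ L, f g ≠ f x) ∧
      ENNReal.ofReal (1 / ((j : ℝ) + 1)) ≤ harmonicMeasure L ∧
      harmonicMeasure L ≤ 2 * ENNReal.ofReal (1 / ((j : ℝ) + 1))) fun j G => by
    obtain ⟨L, hLB, hL, m, hm, hLm⟩ := exists_finset_harmonicMeasure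
      (hI.diff_not_mem (hI.diff_not_mem hB (hI.biUnion G.finite_toSet fun g _ => hfib (f g)))
        (hI.finite (finite_lt_nat j)))
      (ENNReal.ofReal_ne_top (r := 1 / ((j : ℝ) + 1)))
      (ENNReal.ofReal_pos.2 (by positivity)).ne'
    refine ⟨L, fun x hx => (hLB hx).1.1, fun g hg x hx h => (hLB hx).1.2 ?_, hL, hLm.trans ?_⟩
    · exact mem_iUnion₂.2 ⟨g, hg, (hLB hx).1.1, h.symm⟩
    · rw [two_mul, harmonicMeasure_singleton]
      gcongr
      exact_mod_cast not_lt.1 hm.2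
  have hne : ∀ i j, i < j → ∀ x ∈ L i, ∀ y ∈ L j, f x ≠ f y := fun i j hij x hx y hy =>
    (hL j).2.1 x (Finset.mem_biUnion.2 ⟨i, Finset.mem_range.2 hij, hx⟩) y hy
  have hdis : ∀ i j, i < j → Disjoint (L i) (L j) := fun i j hij =>
    Finset.disjoint_left.2 fun x hx hx' => hne i j hij x hx x hx' rfl
  have hfibL : ∀ i, ∀ x ∈ L i, (⋃ j, (L j : Set ℕ)) ∩ f ⁻¹' {f x} ⊆ L i := by
    rintro i x hx y ⟨hy, hxy⟩
    obtain ⟨j, hj⟩ := mem_iUnion.1 hy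
    rcases lt_trichotomy i j with h | rfl | h
    · exact (hne i j h x hx y hj (Eq.symm hxy)).elim
    · exact hj
    · exact (hne j i h y hj x hx hxy).elim
  refine ⟨⋃ j, (L j : Set ℕ), iUnion_subset fun j => (hL j).1, ?_, fun n => ?_, ?_⟩
  · have h := harmonicMeasure_biUnion hdis univ
    simp only [mem_univ, iUnion_true, tsum_univ (fun j => harmonicMeasure (L j : Set ℕ))] at h
    rw [notMem_summableIdeal, h, ← top_le_iff, ← tsum_one_div_eq_top]
    exact ENNReal.tsum_le_tsum fun j => (hL j).2.2.1
  · exact mem_summableIdeal.1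
      (hI.mono (inter_subset_inter_left _ (iUnion_subset fun j => (hL j).1)) (hfib n))
  · have hlim : Tendsto (fun j : ℕ => 2 * ENNReal.ofReal (1 / ((j : ℝ) + 1))) atTop (𝓝 0) := by
      have := ENNReal.tendsto_ofReal (tendsto_one_div_add_atTop_nhds_zero_nat (𝕜 := ℝ))
      simpa using ENNReal.Tendsto.const_mul this (Or.inr (ENNReal.ofNat_ne_top (n := 2)))
    rw [ENNReal.tendsto_atTop_zero] at hlim ⊢
    intro ε hε
    obtain ⟨M, hM⟩ := hlim ε hε
    obtain ⟨N, hN⟩ := (((Finset.range M).biUnion L).image f).bddAbove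
    refine ⟨N + 1, fun n hn => ?_⟩
    rcases eq_empty_or_nonempty ((⋃ j, (L j : Set ℕ)) ∩ f ⁻¹' {n}) with h | ⟨x, hx, rfl⟩
    · simp [h]
    · obtain ⟨i, hi⟩ := mem_iUnion.1 hx
      refine (measure_mono (hfibL i x hi)).trans ((hL i).2.2.2.trans (hM i ?_))
      refine le_of_not_gt fun hiM => ?_
      have : f x ≤ N := hN (Finset.mem_coe.2 (Finset.mem_image_of_mem _
        (Finset.mem_biUnion.2 ⟨i, Finset.mem_range.2 hiM, hi⟩)))
      lia

/-- The summable ideal can be distinguished from every ideal for which positivity is witnessed by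
small finite sets. -/
theorem exists_space_hasBW_summableIdeal (CH : Cardinal.continuum.{0} = Cardinal.aleph.{0} 1)
    {J : Set (Set ℕ)} (hJ : IsSetIdeal J) {Big : ℕ → Finset ℕ → Prop} (hW : HasWitnesses J Big)
    (hcard : ∀ j L, Big j L → L.card ≤ j + 1) :
    ∃ (X : Type) (_ : TopologicalSpace X),
      T2Space X ∧ HasBW summableIdeal X ∧ ¬ CompactSpace X ∧ ¬ HasBW J X := by
  have hI := isSetIdeal_summableIdeal
  refine exists_space_hasBW_not_hasBW CH hI (hasWitnesses_summableIdeal.isPPlus hI) hJ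
    HasVanishingFibers (fun f => by simp [HasVanishingFibers]) exists_hasVanishingFibers
    fun f C hC B hB => ?_
  have hg : ∀ j, ∃ N, ∀ k < j, ∀ n ≥ N,
      harmonicMeasure (C k ∩ f k ⁻¹' {n}) ≤ ENNReal.ofReal (1 / 2 ^ j) := fun j => by
    have : ∀ᶠ n in atTop, ∀ k ∈ {k | k < j},
        harmonicMeasure (C k ∩ f k ⁻¹' {n}) ≤ ENNReal.ofReal (1 / 2 ^ j) :=
      (eventually_all_finite (finite_lt_nat j)).2 fun k _ =>
        (hC k).2.eventually (ge_mem_nhds (ENNReal.ofReal_pos.2 (by positivity)))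
    obtain ⟨N, hN⟩ := eventually_atTop.1 this
    exact ⟨N, fun k hk n hn => hN n hn k hk⟩
  choose g hg using hg
  obtain ⟨L, hLB, hL, S, hSB, hS, hS', hSL⟩ := hW.exists_split hJ (B := fun j => B \ {n | n < g j})
    (fun j => hJ.diff_not_mem hB (hJ.finite (finite_lt_nat _))) fun j => sdiff_subset
  refine ⟨S, hSB, hS, hS', fun k => ?_⟩
  -- Blocks j ≤ k contribute finitely many fibres in I; blocks j > k contribute at most (j + 1) 2⁻ʲ
  -- each.
  have hsub : C k ∩ f k ⁻¹' S ⊆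
      (⋃ n ∈ ((Finset.range (k + 1)).biUnion L : Set ℕ), C k ∩ f k ⁻¹' {n}) ∪
      ⋃ j, ⋃ n ∈ (if k < j then L j else ∅), C k ∩ f k ⁻¹' {n} := by
    rintro x ⟨hxC, hxS⟩
    obtain ⟨j, hj⟩ := mem_iUnion.1 (hSL hxS)
    by_cases hjk : k < j
    · refine Or.inr (mem_iUnion.2 ⟨j, mem_iUnion₂.2 ⟨f k x, ?_, hxC, rfl⟩⟩)
      rw [if_pos hjk]
      exact hj
    · refine Or.inl (mem_iUnion₂.2 ⟨f k x, ?_, hxC, rfl⟩)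
      simp only [Finset.mem_coe, Finset.mem_biUnion, Finset.mem_range]
      exact ⟨j, by lia, hj⟩
  refine hI.mono hsub (hI.union (hI.biUnion (Finset.finite_toSet _) fun n _ =>
    mem_summableIdeal.2 ((hC k).1 n)) (mem_summableIdeal.2 ?_))
  refine ne_top_of_le_ne_top ENNReal.tsum_card_mul_ne_top
    ((measure_iUnion_le _).trans (ENNReal.tsum_le_tsum fun j => ?_))
  by_cases hjk : k < j
  · rw [if_pos hjk]
    refine (measure_biUnion_finset_le _ _).trans
      ((Finset.sum_le_card_nsmul _ _ (ENNReal.ofReal (1 / 2 ^ j)) fun n hn =>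
        hg j k hjk n (not_lt.1 (hLB j hn).2)).trans ?_)
    rw [nsmul_eq_mul]
    gcongr
    exact_mod_cast hcard j _ (hL j)
  · simp [if_neg hjk]

end Summable

/-! ### The five spaces -/

theorem corollary5p4 (CH : Cardinal.continuum.{0} = Cardinal.aleph.{0} 1) :
    (∃ (X : Type) (_ : TopologicalSpace X),
      T2Space X ∧ SeqCompactSpace X ∧ ¬ CompactSpace X ∧ ¬ HasBW vanDerWaerdenIdeal X) ∧
    (∃ (X : Type) (_ : TopologicalSpace X),
      T2Space X ∧ SeqCompactSpace X ∧ ¬ CompactSpace X ∧ ¬ HasBW summableIdeal X) ∧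
    (∃ (X : Type) (_ : TopologicalSpace X),
      T2Space X ∧ HasBW summableIdeal X ∧ ¬ CompactSpace X ∧ ¬ SeqCompactSpace X) ∧
    (∃ (X : Type) (_ : TopologicalSpace X),
      T2Space X ∧ HasBW vanDerWaerdenIdeal X ∧ ¬ CompactSpace X ∧ ¬ HasBW summableIdeal X) ∧
    (∃ (X : Type) (_ : TopologicalSpace X),
      T2Space X ∧ HasBW summableIdeal X ∧ ¬ CompactSpace X ∧ ¬ HasBW vanDerWaerdenIdeal X) := by
  refine ⟨?_, ?_, ?_, ?_, ?_⟩
  · obtain ⟨X, _, h1, h2, h3, h4⟩ := exists_space_of_image_mem CH isSetIdeal_finiteIdeal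
      hasWitnesses_finiteIdeal isSetIdeal_vanDerWaerdenIdeal hasWitnesses_vanDerWaerdenIdeal
      exists_infinite_image_mem_vanDerWaerdenIdeal
    exact ⟨X, _, h1, h2.seqCompactSpace, h3, h4⟩
  · obtain ⟨X, _, h1, h2, h3, h4⟩ := exists_space_of_image_mem CH isSetIdeal_finiteIdeal
      hasWitnesses_finiteIdeal isSetIdeal_summableIdeal hasWitnesses_summableIdeal
      (hasWitnesses_finiteIdeal.exists_image_mem_summableIdeal isSetIdeal_finiteIdeal
        fun _ _ h => h.2)
    exact ⟨X, _, h1, h2.seqCompactSpace, h3, h4⟩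
  · obtain ⟨X, _, h1, h2, h3, h4⟩ := exists_space_hasBW_summableIdeal CH isSetIdeal_finiteIdeal
      hasWitnesses_finiteIdeal fun _ _ h => h.2
    exact ⟨X, _, h1, h2, h3, fun _ => h4 HasBW.of_seqCompactSpace⟩
  · exact exists_space_of_image_mem CH isSetIdeal_vanDerWaerdenIdeal
      hasWitnesses_vanDerWaerdenIdeal isSetIdeal_summableIdeal hasWitnesses_summableIdeal
      (hasWitnesses_vanDerWaerdenIdeal.exists_image_mem_summableIdeal
        isSetIdeal_vanDerWaerdenIdeal fun _ _ h => h.2)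
  · exact exists_space_hasBW_summableIdeal CH isSetIdeal_vanDerWaerdenIdeal
      hasWitnesses_vanDerWaerdenIdeal fun _ _ h => h.2
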